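/- Let $K=\mathbb{R}$ (or $K=\mathbb{C}$), and let $n\ge 1$, $k\ge 1$, $d\ge 1$ be integers. Let $$\Theta^H_{n,k}=\Big\{\big((\mu_1,\dots,\mu_k),(\lambda_1,\dots,\lambda_k),\Sigma\big)\ :\ \mu_i\in K^n,\ \lambda_i\in K,\ \textstyle\sum_i\lambda_i=1,\ \Sigma\in\operatorname{Sym}^2K^n\Big\},$$ an affine space of dimension $nk+(k-1)+\tfrac{n(n+1)}2$, be the parameter space of homoscedastic mixtures of $k$ Gaussians in dimension $n$. Let $M_{n,k,d}$ be the moment map, which sends a parameter to the vector $(m_a)_{a\in\mathbb{N}^n,\ |a|\le d}$ of moments of order at most $d$, defined by $$\sum_{a\in\mathbb{N}^n} m_a\,\frac{u_1^{a_1}\cdots u_n^{a_n}}{a_1!\cdots a_n!}=\sum_{i=1}^k\lambda_i\exp\!\big(u^t\mu_i+\tfrac12u^t\Sigma u\big)\in K[\![u_1,\dots,u_n]\!],$$ and let the homoscedastic secant variety $\operatorname{Sec}^H_k(\mathcal{G}_{n,d})$ be the image of $M_{n,k,d}$. A property holds for a general point of $\operatorname{Sec}^H_k(\mathcal{G}_{n,d})$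 if it holds at every point of it where some polynomial, not vanishing identically on $\operatorname{Sec}^H_k(\mathcal{G}_{n,d})$, is nonzero. Call $\operatorname{Sec}^H_k(\mathcal{G}_{n,d})$ *algebraically identifiable* if $\dim\Theta^H_{n,k}-\dim\operatorname{Sec}^H_k(\mathcal{G}_{n,d})=0$ (where $\dim$ is the dimension of the Zariski closure) and the fiber of $M_{n,k,d}$ over a general point of $\operatorname{Sec}^H_k(\mathcal{G}_{n,d})$ is finite. Call it *rationally identifiable* if the fiber of $M_{n,k,d}$ over a general point is a single point up to label swapping, that is, up to simultaneous permutation of the pairs $(\mu_i,\lambda_i)$. **Theorem.** For every $n\ge1$, the homoscedastic secant $\operatorname{Sec}^H_2(\mathcal{G}_{n,4})$ is algebraically identifiable. For every $n\ge 1$ and every $d\ge5$, the homoscedastic secant $\operatorname{Sec}^H_2(\mathcal{G}_{n,d})$ is algebraically and also rationally identifiable. -/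

import Mathlib

noncomputable section

namespace HomoscedasticMixture

/-- The parameter space `Θ^H_{n,k}` of homoscedastic `k`-mixtures of Gaussians in dimension `n`:
`k` mean vectors, `k` mixture weights with sum one, and one common symmetric covariance matrix. -/
@[ext]
structure Params (K : Type*) [Field K] (n k : ℕ) where
  /-- the mean vectors -/
  mean : Fin k → Fin n → K
  /-- the mixture weights -/
  weight : Fin k → K
  /-- the common covariance matrix -/
  cov : Matrix (Fin n) (Fin n) K
  weight_sum : ∑ i, weight i = 1
  cov_symm : cov.IsSymm

/-- Label swapping: the `k` components (weight and mean) are permuted by `π`. -/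
def Params.relabel {K : Type*} [Field K] {n k : ℕ} (θ : Params K n k)
    (π : Equiv.Perm (Fin k)) : Params K n k where
  mean i := θ.mean (π i)
  weight i := θ.weight (π i)
  cov := θ.cov
  weight_sum := (Equiv.sum_comp π θ.weight).trans θ.weight_sum
  cov_symm := θ.cov_symm

/-- The dimension of `Θ^H_{n,k} ≅ (K^n)^k × K^(k-1) × Sym²(K^n)`, for `k ≥ 1`. -/
def paramDim (n k : ℕ) : ℕ := n * k + (k - 1) + n * (n + 1) / 2

section Moments

variable {K : Type*} [Field K] [CharZero K]

/-- The cumulant generating function `uᵗ μ + (1/2) uᵗ Σ u` of the Gaussian with mean `μ` and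
covariance matrix `Σ`, as a formal power series in `u = (u_1, …, u_n)`. -/
def gaussianCGF {n : ℕ} (μ : Fin n → K) (S : Matrix (Fin n) (Fin n) K) :
    MvPowerSeries (Fin n) K :=
  ∑ i, MvPowerSeries.C (μ i) * MvPowerSeries.X i +
    MvPowerSeries.C (1 / 2 : K) *
      ∑ i, ∑ j, MvPowerSeries.C (S i j) * (MvPowerSeries.X i * MvPowerSeries.X j)

/-- The moment generating function `exp (uᵗ μ + (1/2) uᵗ Σ u)` of the Gaussian. -/
def gaussianMGF {n : ℕ} (μ : Fin n → K) (S : Matrix (Fin n) (Fin n) K) :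
    MvPowerSeries (Fin n) K :=
  (PowerSeries.exp K).subst (gaussianCGF μ S)

/-- The moment generating function of a homoscedastic mixture. -/
def mixtureMGF {n k : ℕ} (θ : Params K n k) : MvPowerSeries (Fin n) K :=
  ∑ i, MvPowerSeries.C (θ.weight i) * gaussianMGF (θ.mean i) θ.cov

/-- The multi-indices `a = (a_1, …, a_n)` with `a_1 + … + a_n ≤ d`. -/
abbrev MultiIndex (n d : ℕ) : Type := {a : Fin n →₀ ℕ // a.degree ≤ d}

/-- The moment map `M_{n,k,d}`: the vector of all moments of order at most `d`, where the moment
`m_a` is the coefficient of `u_1^{a_1} ⋯ u_n^{a_n} / (a_1! ⋯ a_n!)` in the moment generating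
function. (The coordinate `m_0` is always `1`.) -/
def momentMap {n k : ℕ} (d : ℕ) (θ : Params K n k) : MultiIndex n d → K :=
  fun a => (∏ i, ((a.1 i).factorial : K)) * MvPowerSeries.coeff a.1 (mixtureMGF θ)

variable (K) in
/-- The homoscedastic `k`-secant variety `Sec^H_k(G_{n,d})`: the image of the moment map. -/
def homoscedasticSecant (n k d : ℕ) : Set (MultiIndex n d → K) :=
  Set.range (momentMap d : Params K n k → MultiIndex n d → K)

end Moments

/-- The dimension of a subset of an affine space, that is, of its Zariski closure: the Krull
dimension of the ring of polynomial functions on it. -/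
def zariskiDim {K : Type*} [Field K] {σ : Type*} (S : Set (σ → K)) : WithBot ℕ∞ :=
  ringKrullDim (MvPolynomial σ K ⧸ MvPolynomial.vanishingIdeal K S)

/-- A general point of `S` satisfies `P`: the property holds at all points of `S` at which a
certain polynomial, not identically zero on `S`, does not vanish. (For irreducible `S`, such as
the image of an affine space under a polynomial map, these loci are dense open in `S`.) -/
def ForGeneralPoint {K : Type*} [Field K] {σ : Type*} (S : Set (σ → K))
    (P : (σ → K) → Prop) : Prop :=
  ∃ Q : MvPolynomial σ K,
    (∃ x ∈ S, MvPolynomial.eval x Q ≠ 0) ∧ ∀ x ∈ S, MvPolynomial.eval x Q ≠ 0 → P x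

/-- `Sec^H_k(G_{n,d})` is algebraically identifiable: the fiber dimension
`dim Θ^H_{n,k} - dim Sec^H_k(G_{n,d})` is zero, and the fiber of the moment map over a general
point is finite. -/
def AlgebraicallyIdentifiable (K : Type*) [Field K] [CharZero K] (n k d : ℕ) : Prop :=
  zariskiDim (homoscedasticSecant K n k d) = (paramDim n k : WithBot ℕ∞) ∧
    ForGeneralPoint (homoscedasticSecant K n k d)
      fun m => {θ : Params K n k | momentMap d θ = m}.Finite

/-- `Sec^H_k(G_{n,d})` is rationally identifiable: the fiber of the moment map over a general
point is a single point up to label swapping. -/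
def RationallyIdentifiable (K : Type*) [Field K] [CharZero K] (n k d : ℕ) : Prop :=
  ForGeneralPoint (homoscedasticSecant K n k d)
    fun m => ∃ θ : Params K n k,
      {θ' : Params K n k | momentMap d θ' = m} = Set.range θ.relabel

end HomoscedasticMixture

end

/-!
The identifiability of homoscedastic mixtures of two Gaussians is reduced to one dimension: the
projection of the mixture to a direction `v` is a univariate mixture with the same weights, with
means `v ⬝ μᵢ` and with variance `vᵗ Σ v`, and its moments are linear in the moments of the mixture
(`directionalMoment_genericMoment`).

Let `p` be the first weight, `s = p (1 - p)` and let `x` be the difference of the two means of a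
univariate mixture. The common variance enters only the second cumulant, and the next ones are
`κ₃ = s (1 - 2p) x³`, `κ₄ = s (1 - 6s) x⁴`, `κ₅ = s (1 - 2p) (1 - 12s) x⁵`. The locus where `κ₃` in
the direction of one coordinate does not vanish is the general locus for all the statements.

* Elimination of `x` from `κ₃` and `κ₄` gives a polynomial equation for `p` with constant term
  `-κ₃⁴` (`weightPolynomial`). So `p` is one of finitely many values, and so is `x`, whose cube is
  known once `p` is.
* With `κ₅` and `r = κ₅ / κ₃` one has `r² + 24 κ₄ = x⁴` and `s x² · x⁴ = 18 κ₃² + r κ₄`. So `x⁴` and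
  then `s x²`, `x²` and `(1 - 2p) x` are determined, that is, `(p, x)` up to the label swap
  `(1 - p, -x)` (`eq_or_swap_of_cumulants`).
* Given `p` and `x` for one coordinate, the third cumulants in all directions determine the
  difference of the mean vectors, and the first two cumulants determine the mean vectors and the
  covariance matrix (`eq_of_momentMap_eq`).

For the dimension, the same identities are applied to the generic mixture, whose parameters are
indeterminates: they show that the polynomial ring of the parameters is algebraic over the
subalgebra of the moments (`isAlgebraic_parameter`). This subalgebra is the coordinate ring of the
secant variety, and its Krull dimension is its transcendence degree, by Noether normalization
(`zariskiDim_range_eq_card`).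
-/

namespace HomoscedasticMixture

/-! ### Krull dimension of algebras of finite type -/

/-- An integral extension does not change the Krull dimension: incomparability bounds the dimension
of the larger ring, going up that of the smaller one. -/
theorem ringKrullDim_eq_of_isIntegral {R S : Type*} [CommRing R] [CommRing S] [Algebra R S]
    [Algebra.IsIntegral R S] (hinj : Function.Injective (algebraMap R S)) :
    ringKrullDim S = ringKrullDim R := by
  apply le_antisymm
  · refine Order.krullDim_le_of_strictMono (PrimeSpectrum.comap (algebraMap R S)) ?_
    intro I J hIJ
    exact Ideal.IsIntegral.comap_lt_comap (A := S) (R := R) hIJ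
  · refine iSup_le fun l => ?_
    have : FaithfulSMul R S := (faithfulSMul_iff_algebraMap_injective R S).mpr hinj
    obtain ⟨P, hP, hPl⟩ := Ideal.nonempty_primesOver (S := S) l.head.asIdeal
    obtain ⟨L, hL, -⟩ := Ideal.exists_ltSeries_of_hasGoingUp l P
    exact hL ▸ Order.LTSeries.length_le_krullDim L

/-- The Krull dimension of a finitely generated domain over a field is its transcendence degree. -/
theorem ringKrullDim_eq_of_trdeg {K A : Type*} [Field K] [CommRing A] [IsDomain A] [Algebra K A]
    [Algebra.FiniteType K A] {N : ℕ} (h : Algebra.trdeg K A = N) : ringKrullDim A = N := by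
  obtain ⟨s, g, hg, hint⟩ := exists_integral_inj_algHom_of_fg K A
  algebraize [g.toRingHom]
  have hs : ringKrullDim A = s := by
    rw [ringKrullDim_eq_of_isIntegral (R := MvPolynomial (Fin s) K) hg,
      MvPolynomial.ringKrullDim_of_isNoetherianRing]
    simp
  have : FaithfulSMul (MvPolynomial (Fin s) K) A :=
    (faithfulSMul_iff_algebraMap_injective _ _).mpr hg
  have : IsScalarTower K (MvPolynomial (Fin s) K) A :=
    .of_algebraMap_eq fun x => (g.commutes x).symm
  have ht := lift_trdeg_add_eq K (MvPolynomial (Fin s) K) A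
  rw [trdeg_eq_zero (R := MvPolynomial (Fin s) K) (A := A), h] at ht
  simp at ht
  rw [hs]
  exact_mod_cast ht

/-- If all coordinates are algebraic over the components of a polynomial map, then the closure of
its image has the dimension of the source. -/
theorem zariskiDim_range_eq_card {K σ τ : Type*} [Field K] [Infinite K] [Finite σ] [Fintype τ]
    (F : σ → MvPolynomial τ K)
    (halg : ∀ t : τ, IsAlgebraic (Algebra.adjoin K (Set.range F))
      (MvPolynomial.X t : MvPolynomial τ K)) :
    zariskiDim (Set.range fun (v : τ → K) (a : σ) => MvPolynomial.eval v (F a)) =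
      (Fintype.card τ : WithBot ℕ∞) := by
  set A := Algebra.adjoin K (Set.range F)
  -- Over an infinite field a polynomial vanishes on the image iff its composite with `F` is zero.
  have hker : MvPolynomial.vanishingIdeal K
      (Set.range fun (v : τ → K) (a : σ) => MvPolynomial.eval v (F a)) =
      RingHom.ker (MvPolynomial.aeval F : MvPolynomial σ K →ₐ[K] MvPolynomial τ K) := by
    ext f
    rw [MvPolynomial.mem_vanishingIdeal_iff, RingHom.mem_ker, MvPolynomial.funext_iff,
      Set.forall_mem_range]
    refine forall_congr' fun v => ?_
    rw [map_zero]
    have : MvPolynomial.eval v (MvPolynomial.aeval F f) =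
        MvPolynomial.aeval (fun a => MvPolynomial.eval v (F a)) f := by
      have h2 := MvPolynomial.comp_aeval_apply (R := K) (f := F) (MvPolynomial.aeval v) f
      simpa [MvPolynomial.aeval_eq_eval] using h2
    rw [this]
  have hrange : (MvPolynomial.aeval F : MvPolynomial σ K →ₐ[K] MvPolynomial τ K).range = A :=
    (Algebra.adjoin_range_eq_range_aeval K F).symm
  have e : (MvPolynomial σ K ⧸ MvPolynomial.vanishingIdeal K
      (Set.range fun (v : τ → K) (a : σ) => MvPolynomial.eval v (F a))) ≃+* A :=
    (Ideal.quotEquivOfEq hker).trans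
      ((Ideal.quotientKerEquivRange
        (MvPolynomial.aeval F : MvPolynomial σ K →ₐ[K] MvPolynomial τ K)).trans
        (Subalgebra.equivOfEq _ _ hrange)).toRingEquiv
  rw [zariskiDim, ringKrullDim_eq_of_ringEquiv e]
  have : Algebra.FiniteType K A :=
    A.fg_iff_finiteType.mp (Subalgebra.fg_def.mpr ⟨_, Set.finite_range F, rfl⟩)
  have : Algebra.IsAlgebraic A (MvPolynomial τ K) := by
    refine ⟨fun f => ?_⟩
    induction f using MvPolynomial.induction_on with
    | C c => exact isAlgebraic_algebraMap (algebraMap K A c)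
    | add f g hf hg => exact hf.add hg
    | mul_X f t hf => exact hf.mul (halg t)
  apply ringKrullDim_eq_of_trdeg (K := K)
  have ht := trdeg_add_eq K A (A := MvPolynomial τ K)
  rw [trdeg_eq_zero (R := A), add_zero, MvPolynomial.trdeg_of_isDomain] at ht
  simpa using ht

/-! ### Moments in a direction -/

open Finset

section Restrict

variable {R : Type*} [CommRing R] {n : ℕ}

/-- The restriction of a multivariate power series to the line spanned by `v`. -/
theorem coeff_subst_line (v : Fin n → R) (f : MvPowerSeries (Fin n) R) (r : ℕ) :
    PowerSeries.coeff r
        (f.subst (fun i => PowerSeries.C (v i) * PowerSeries.X : Fin n → PowerSeries R)) =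
      ∑ a ∈ finsuppAntidiag univ r, MvPowerSeries.coeff a f * ∏ i, v i ^ a i := by
  have hs : MvPowerSeries.HasSubst
      (fun i => PowerSeries.C (v i) * PowerSeries.X : Fin n → PowerSeries R) :=
    MvPowerSeries.hasSubst_of_constantCoeff_zero fun i => by
      change PowerSeries.constantCoeff _ = 0
      simp
  have hprod : ∀ a : Fin n →₀ ℕ, PowerSeries.coeff r
      (a.prod fun s e => (PowerSeries.C (v s) * PowerSeries.X : PowerSeries R) ^ e) =
        if r = ∑ i, a i then ∏ i, v i ^ a i else 0 := by
    intro a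
    rw [Finsupp.prod_fintype _ _ (by simp)]
    simp_rw [mul_pow, prod_mul_distrib, prod_pow_eq_pow_sum, ← map_pow, ← map_prod]
    rw [PowerSeries.coeff_C_mul, PowerSeries.coeff_X_pow]
    simp
  have h := MvPowerSeries.coeff_subst hs f (Finsupp.single () r)
  rw [finsum_eq_sum_of_support_subset (s := finsuppAntidiag univ r)] at h
  · refine h.trans (sum_congr rfl fun a ha => ?_)
    have := hprod a
    rw [PowerSeries.coeff] at this
    rw [this, if_pos (by simpa [eq_comm] using (mem_finsuppAntidiag.mp ha).1), smul_eq_mul]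
  · intro a ha
    have := hprod a
    rw [PowerSeries.coeff] at this
    rw [Function.mem_support, this] at ha
    rw [mem_coe, mem_finsuppAntidiag]
    by_contra hc
    apply ha
    rw [if_neg, smul_zero]
    rintro rfl
    simp at hc

end Restrict

/-- The `r`-th moment of the univariate Gaussian with mean `m` and variance `s`, given by the
recursion that its moment generating function satisfies as a solution of `y' = (m + s x) y`. -/
def gaussianMoment {R : Type*} [CommRing R] (m s : R) : ℕ → R
  | 0 => 1
  | 1 => m
  | r + 2 => m * gaussianMoment m s (r + 1) + (r + 1) * s * gaussianMoment m s r

section Generic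

variable {R : Type*} [CommRing R] [Algebra ℚ R] {n : ℕ}

/-- The moment generating function `exp (m x + c x ^ 2)` of a univariate Gaussian of variance `2 c`
has the moments `gaussianMoment m (2 * c)`. -/
theorem factorial_mul_coeff_exp_subst (m c : R) (r : ℕ) :
    (r.factorial : R) * PowerSeries.coeff r ((PowerSeries.exp R).subst
      (PowerSeries.C m * PowerSeries.X + PowerSeries.C c * PowerSeries.X ^ 2 : PowerSeries R)) =
      gaussianMoment m (2 * c) r := by
  set g : PowerSeries R := PowerSeries.C m * PowerSeries.X + PowerSeries.C c * PowerSeries.X ^ 2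
    with hg
  have hs : PowerSeries.HasSubst g := PowerSeries.HasSubst.of_constantCoeff_zero' (by simp [hg])
  set E : PowerSeries R := (PowerSeries.exp R).subst g with hE
  have hE0 : PowerSeries.coeff 0 E = 1 := by
    rw [PowerSeries.coeff_zero_eq_constantCoeff_apply]
    refine (PowerSeries.constantCoeff_subst hs _).trans ?_
    rw [finsum_eq_single _ 0]
    · simp
    · intro e he
      rw [map_pow]
      have : MvPowerSeries.constantCoeff g = 0 := by
        change PowerSeries.constantCoeff g = 0
        simp [hg]
      simp [this, he]
  have hd : PowerSeries.derivative R E =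
      E * (PowerSeries.C m + PowerSeries.C (2 * c) * PowerSeries.X) := by
    rw [hE, PowerSeries.derivative_subst hs, PowerSeries.derivative_exp]
    congr 1
    rw [hg]
    simp [map_ofNat (PowerSeries.C (R := R)) 2]
    ring
  have h1 : PowerSeries.coeff 1 E = m := by
    have := congrArg (PowerSeries.coeff 0) hd
    rw [PowerSeries.coeff_derivative] at this
    rw [PowerSeries.coeff_zero_eq_constantCoeff_apply] at hE0
    simpa [hE0] using this
  have h2 : ∀ r, PowerSeries.coeff (r + 2) E * (r + 2) =
      m * PowerSeries.coeff (r + 1) E + 2 * c * PowerSeries.coeff r E := by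
    intro r
    have := congrArg (PowerSeries.coeff (r + 1)) hd
    rw [PowerSeries.coeff_derivative, mul_add E, map_add, PowerSeries.coeff_mul_C, ← mul_assoc,
      PowerSeries.coeff_succ_mul_X, PowerSeries.coeff_mul_C] at this
    push_cast at this
    linear_combination this
  induction r using Nat.twoStepInduction with
  | zero => simp [gaussianMoment, hE0]
  | one => simp [gaussianMoment, h1]
  | more r ih0 ih1 =>
    rw [gaussianMoment, ← ih0, ← ih1, Nat.factorial_succ (r + 1), Nat.factorial_succ r]
    push_cast
    linear_combination ((r + 1) * r.factorial : R) * h2 r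

/-- The moment generating function of a Gaussian with parameters in an arbitrary `ℚ`-algebra. -/
noncomputable def genericMGF (μ : Fin n → R) (S : Matrix (Fin n) (Fin n) R) :
    MvPowerSeries (Fin n) R :=
  (PowerSeries.exp R).subst (∑ i, MvPowerSeries.C (μ i) * MvPowerSeries.X i +
    MvPowerSeries.C (algebraMap ℚ R (1 / 2)) *
      ∑ i, ∑ j, MvPowerSeries.C (S i j) * (MvPowerSeries.X i * MvPowerSeries.X j) :
        MvPowerSeries (Fin n) R)

omit [Algebra ℚ R] in
theorem hasSubst_cgf (μ : Fin n → R) (S : Matrix (Fin n) (Fin n) R) (c : R) :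
    PowerSeries.HasSubst (∑ i, MvPowerSeries.C (μ i) * MvPowerSeries.X i +
    MvPowerSeries.C c *
      ∑ i, ∑ j, MvPowerSeries.C (S i j) * (MvPowerSeries.X i * MvPowerSeries.X j) :
        MvPowerSeries (Fin n) R) :=
  PowerSeries.HasSubst.of_constantCoeff_zero (by simp)

theorem map_genericMGF {R' : Type*} [CommRing R'] [Algebra ℚ R'] (φ : R →+* R') (μ : Fin n → R)
    (S : Matrix (Fin n) (Fin n) R) :
    MvPowerSeries.map φ (genericMGF μ S) = genericMGF (fun i => φ (μ i)) (S.map φ) := by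
  rw [genericMGF, PowerSeries.map_subst (hasSubst_cgf _ _ _), PowerSeries.map_exp, genericMGF]
  simp

/-- Restricted to the line spanned by `v`, a Gaussian is the univariate Gaussian with mean `v ⬝ μ`
and variance `vᵗ Σ v`. -/
theorem sum_coeff_genericMGF (v μ : Fin n → R) (S : Matrix (Fin n) (Fin n) R) (r : ℕ) :
    (r.factorial : R) *
      ∑ a ∈ finsuppAntidiag univ r, MvPowerSeries.coeff a (genericMGF μ S) * ∏ i, v i ^ a i =
    gaussianMoment (∑ i, v i * μ i) (∑ i, ∑ j, v i * v j * S i j) r := by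
  have hs : MvPowerSeries.HasSubst
      (fun i => PowerSeries.C (v i) * PowerSeries.X : Fin n → PowerSeries R) :=
    MvPowerSeries.hasSubst_of_constantCoeff_zero fun i => by
      change PowerSeries.constantCoeff _ = 0
      simp
  have h2 : (2 : R) * algebraMap ℚ R (1 / 2) = 1 := by
    rw [show (2 : R) = algebraMap ℚ R 2 from (map_ofNat _ 2).symm, ← map_mul]
    norm_num
  rw [← coeff_subst_line, genericMGF, PowerSeries.subst,
    MvPowerSeries.subst_comp_subst_apply (hasSubst_cgf _ _ _).const hs]
  have key : MvPowerSeries.subst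
      (fun i => PowerSeries.C (v i) * PowerSeries.X : Fin n → PowerSeries R)
      (∑ i, MvPowerSeries.C (μ i) * MvPowerSeries.X i +
        MvPowerSeries.C (algebraMap ℚ R (1 / 2)) *
          ∑ i, ∑ j, MvPowerSeries.C (S i j) * (MvPowerSeries.X i * MvPowerSeries.X j) :
            MvPowerSeries (Fin n) R) =
      PowerSeries.C (∑ i, v i * μ i) * PowerSeries.X +
        PowerSeries.C (algebraMap ℚ R (1 / 2) * ∑ i, ∑ j, v i * v j * S i j) *
          PowerSeries.X ^ 2 := by
    have hC : ∀ c : R, MvPowerSeries.subst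
      (fun i => PowerSeries.C (v i) * PowerSeries.X : Fin n → PowerSeries R)
      (MvPowerSeries.C c : MvPowerSeries (Fin n) R) = PowerSeries.C c := fun c =>
        MvPowerSeries.subst_C c
    rw [← MvPowerSeries.coe_substAlgHom hs] at hC ⊢
    simp only [map_add, map_sum, map_mul, hC, MvPowerSeries.substAlgHom_X, Finset.sum_mul,
      Finset.mul_sum]
    congr 1
    · exact sum_congr rfl fun i _ => by ring
    · exact sum_congr rfl fun i _ => sum_congr rfl fun j _ => by ring
  have := factorial_mul_coeff_exp_subst (∑ i, v i * μ i)
    (algebraMap ℚ R (1 / 2) * ∑ i, ∑ j, v i * v j * S i j) r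
  rw [← mul_assoc, h2, one_mul] at this
  rw [key]
  exact this

/-- The moments of a mixture with parameters in an arbitrary `ℚ`-algebra. -/
noncomputable def genericMoment {k : ℕ} (w : Fin k → R) (μ : Fin k → Fin n → R)
    (S : Matrix (Fin n) (Fin n) R) (a : Fin n →₀ ℕ) : R :=
  (∏ i, ((a i).factorial : R)) *
    MvPowerSeries.coeff a (∑ i, MvPowerSeries.C (w i) * genericMGF (μ i) S)

theorem map_genericMoment {k : ℕ} {R' : Type*} [CommRing R'] [Algebra ℚ R'] (φ : R →+* R')
    (w : Fin k → R) (μ : Fin k → Fin n → R) (S : Matrix (Fin n) (Fin n) R) (a : Fin n →₀ ℕ) :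
    φ (genericMoment w μ S a) =
      genericMoment (fun i => φ (w i)) (fun i j => φ (μ i j)) (S.map φ) a := by
  rw [genericMoment, genericMoment, map_mul, ← MvPowerSeries.coeff_map]
  simp [map_genericMGF]

end Generic

theorem momentMap_eq_genericMoment {K : Type*} [Field K] [CharZero K] {n k d : ℕ}
    (θ : Params K n k) (a : MultiIndex n d) :
    momentMap d θ a = genericMoment θ.weight θ.mean θ.cov a.1 := by
  have h : ∀ i, gaussianMGF (θ.mean i) θ.cov = genericMGF (θ.mean i) θ.cov := by
    intro i
    simp [gaussianMGF, genericMGF, gaussianCGF]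
  simp [momentMap, mixtureMGF, genericMoment, h]

section Directional

variable {K R : Type*} [Field K] [CharZero K] [CommRing R] [Algebra K R] {n d : ℕ}

/-- The `r`-th moment of the projection to the direction `v`, a linear form in the moments
of order `r`. The moments of order above `d`, which are not available, are replaced by `0`. -/
noncomputable def directionalMoment (m : MultiIndex n d → R) (v : Fin n → K) (r : ℕ) : R :=
  ∑ a ∈ finsuppAntidiag univ r, if h : a.degree ≤ d then
    ((r.factorial : K) * (∏ i, ((a i).factorial : K))⁻¹ * ∏ i, v i ^ a i) • m ⟨a, h⟩ else 0

omit [CharZero K] in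
theorem map_directionalMoment {R' : Type*} [CommRing R'] [Algebra K R'] (φ : R →ₐ[K] R')
    (m : MultiIndex n d → R) (v : Fin n → K) (r : ℕ) :
    φ (directionalMoment m v r) = directionalMoment (fun a => φ (m a)) v r := by
  simp only [directionalMoment, map_sum]
  refine sum_congr rfl fun a _ => ?_
  split_ifs <;> simp

omit [CharZero K] in
theorem directionalMoment_mem (A : Subalgebra K R) (m : MultiIndex n d → R) (hm : ∀ a, m a ∈ A)
    (v : Fin n → K) (r : ℕ) : directionalMoment m v r ∈ A := by
  refine A.sum_mem fun a _ => ?_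
  split_ifs
  · exact A.smul_mem (hm _) _
  · exact A.zero_mem

theorem directionalMoment_genericMoment [Algebra ℚ R] {k : ℕ} (w : Fin k → R)
    (μ : Fin k → Fin n → R) (S : Matrix (Fin n) (Fin n) R) (v : Fin n → K) {r : ℕ} (hr : r ≤ d) :
    directionalMoment (fun a : MultiIndex n d => genericMoment w μ S a.1) v r =
      ∑ l, w l * gaussianMoment (∑ i, algebraMap K R (v i) * μ l i)
        (∑ i, ∑ j, algebraMap K R (v i) * algebraMap K R (v j) * S i j) r := by
  simp_rw [← sum_coeff_genericMGF, directionalMoment, mul_sum]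
  rw [sum_comm]
  refine sum_congr rfl fun a ha => ?_
  have hdeg : a.degree = r := by
    rw [Finsupp.degree_eq_sum]; exact (mem_finsuppAntidiag.mp ha).1
  rw [dif_pos (hdeg.trans_le hr), genericMoment, Algebra.smul_def, map_sum]
  simp only [MvPowerSeries.coeff_C_mul]
  have hne : (∏ i, ((a i).factorial : K)) ≠ 0 :=
    prod_ne_zero_iff.mpr fun i _ => by exact_mod_cast (a i).factorial_ne_zero
  have h1 : algebraMap K R ((∏ i, ((a i).factorial : K))⁻¹) * ∏ i, ((a i).factorial : R) = 1 := by
    have : ∏ i, ((a i).factorial : R) = algebraMap K R (∏ i, ((a i).factorial : K)) := by simp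
    rw [this, ← map_mul, inv_mul_cancel₀ hne, map_one]
  rw [map_mul, map_mul, map_natCast, map_prod, mul_sum, mul_sum]
  refine sum_congr rfl fun l _ => ?_
  simp only [map_pow]
  linear_combination ((r.factorial : R) * (∏ i, algebraMap K R (v i) ^ a i) * (w l *
    MvPowerSeries.coeff a (genericMGF (μ l) S))) * h1

end Directional

/-! ### Cumulants of a two-component mixture -/

section Cumulants

variable {R : Type*} [CommRing R]

/-- The second cumulant (variance) in terms of the moments. -/
def secondCumulant (M : ℕ → R) : R := M 2 - M 1 ^ 2

/-- The third cumulant in terms of the moments. -/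
def thirdCumulant (M : ℕ → R) : R := M 3 - 3 * M 2 * M 1 + 2 * M 1 ^ 3

/-- The fourth cumulant in terms of the moments. -/
def fourthCumulant (M : ℕ → R) : R :=
  M 4 - 4 * M 3 * M 1 - 3 * M 2 ^ 2 + 12 * M 2 * M 1 ^ 2 - 6 * M 1 ^ 4

/-- The fifth cumulant in terms of the moments. -/
def fifthCumulant (M : ℕ → R) : R :=
  M 5 - 5 * M 4 * M 1 - 10 * M 3 * M 2 + 20 * M 3 * M 1 ^ 2 + 30 * M 2 ^ 2 * M 1 -
    60 * M 2 * M 1 ^ 3 + 24 * M 1 ^ 5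

theorem map_secondCumulant {S : Type*} [CommRing S] (φ : R →+* S) (M : ℕ → R) :
    φ (secondCumulant M) = secondCumulant fun r => φ (M r) := by
  simp [secondCumulant]

theorem map_thirdCumulant {S : Type*} [CommRing S] (φ : R →+* S) (M : ℕ → R) :
    φ (thirdCumulant M) = thirdCumulant fun r => φ (M r) := by
  simp [thirdCumulant, map_ofNat φ 3, map_ofNat φ 2]

theorem map_fourthCumulant {S : Type*} [CommRing S] (φ : R →+* S) (M : ℕ → R) :
    φ (fourthCumulant M) = fourthCumulant fun r => φ (M r) := by
  simp [fourthCumulant, map_ofNat φ 4, map_ofNat φ 3, map_ofNat φ 12, map_ofNat φ 6]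

open Polynomial in
/-- A polynomial that vanishes at the weights of every univariate two-component mixture with third
cumulant `a` and fourth cumulant `b`. It results from eliminating the difference of the means. -/
noncomputable def weightPolynomial (a b : R) : R[X] :=
  C (b ^ 3) * (X * (1 - X) * (1 - 2 * X) ^ 4) - C (a ^ 4) * (1 - 6 * (X * (1 - X))) ^ 3

theorem weightPolynomial_ne_zero [IsDomain R] {a : R} (ha : a ≠ 0) (b : R) :
    weightPolynomial a b ≠ 0 := by
  intro h
  have := congrArg (Polynomial.eval 0) h
  simp [weightPolynomial, ha] at this

theorem aeval_weightPolynomial {S : Type*} [CommRing S] [Algebra R S] {a b : R} {p x : S}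
    (ha : algebraMap R S a = p * (1 - p) * (1 - 2 * p) * x ^ 3)
    (hb : algebraMap R S b = p * (1 - p) * (1 - 6 * (p * (1 - p))) * x ^ 4) :
    Polynomial.aeval p (weightPolynomial a b) = 0 := by
  simp only [weightPolynomial, map_sub, map_mul, map_pow, Polynomial.aeval_C, Polynomial.aeval_X,
    map_one, map_ofNat, ha, hb]
  ring

end Cumulants

/-- The cumulants of orders three to five determine the weight and the difference of the means up to
label swapping. -/
theorem eq_or_swap_of_cumulants {K : Type*} [Field K] [CharZero K] {p x p' x' : K}
    (h3 : p * (1 - p) * (1 - 2 * p) * x ^ 3 = p' * (1 - p') * (1 - 2 * p') * x' ^ 3)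
    (h4 : p * (1 - p) * (1 - 6 * (p * (1 - p))) * x ^ 4 =
      p' * (1 - p') * (1 - 6 * (p' * (1 - p'))) * x' ^ 4)
    (h5 : p * (1 - p) * (1 - 2 * p) * (1 - 12 * (p * (1 - p))) * x ^ 5 =
      p' * (1 - p') * (1 - 2 * p') * (1 - 12 * (p' * (1 - p'))) * x' ^ 5)
    (hne : p * (1 - p) * (1 - 2 * p) * x ^ 3 ≠ 0) :
    p' = p ∧ x' = x ∨ p' = 1 - p ∧ x' = -x := by
  have hx : x ≠ 0 := by rintro rfl; simp at hne
  have hp : p * (1 - p) ≠ 0 := by intro h; simp [h] at hne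
  -- `r` is the ratio of the fifth and the third cumulant.
  obtain ⟨r, hr⟩ : ∃ r, r = (1 - 12 * (p * (1 - p))) * x ^ 2 := ⟨_, rfl⟩
  have hr' : r = (1 - 12 * (p' * (1 - p'))) * x' ^ 2 := by
    apply mul_left_cancel₀ hne
    rw [hr]
    linear_combination h5 - (1 - 12 * (p' * (1 - p'))) * x' ^ 2 * h3
  -- both sides are `r ^ 2 + 24 κ₄`
  have hy : x ^ 4 = x' ^ 4 := by
    have e : ((1 - 12 * (p * (1 - p))) * x ^ 2) ^ 2 =
        ((1 - 12 * (p' * (1 - p'))) * x' ^ 2) ^ 2 := by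
      rw [← hr, ← hr']
    linear_combination e + 24 * h4
  -- `S = p (1 - p) x ^ 2` satisfies `S (r ^ 2 + 24 κ₄) = 18 κ₃ ^ 2 + r κ₄`
  have hS : p * (1 - p) * x ^ 2 = p' * (1 - p') * x' ^ 2 := by
    have e3 : (p * (1 - p) * (1 - 2 * p) * x ^ 3) ^ 2 =
      (p' * (1 - p') * (1 - 2 * p') * x' ^ 3) ^ 2 := by rw [h3]
    have e4 : r * (p * (1 - p) * (1 - 6 * (p * (1 - p))) * x ^ 4) =
      r * (p' * (1 - p') * (1 - 6 * (p' * (1 - p'))) * x' ^ 4) := by rw [h4]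
    nth_rewrite 1 [hr] at e4
    rw [hr'] at e4
    apply mul_left_cancel₀ (pow_ne_zero 4 hx)
    nth_rewrite 2 [hy]
    linear_combination 18 * e3 + e4
  have hx2 : x' ^ 2 = x ^ 2 := by linear_combination hr - hr' - 12 * hS
  have hw : (1 - 2 * p) * x = (1 - 2 * p') * x' := by
    apply mul_left_cancel₀ (mul_ne_zero hp (pow_ne_zero 2 hx))
    linear_combination h3 - (1 - 2 * p') * x' * hS
  rcases sq_eq_sq_iff_eq_or_eq_neg.mp hx2 with rfl | rfl
  · left
    refine ⟨?_, rfl⟩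
    have := mul_right_cancel₀ hx hw
    linear_combination this / 2
  · right
    refine ⟨?_, rfl⟩
    have := mul_right_cancel₀ hx (hw.trans (by ring : _ = (-(1 - 2 * p')) * x))
    linear_combination -this / 2

section Directions

variable {K R : Type*} [Field K] [CommRing R] [Algebra K R] {n : ℕ}

/-- The linear form `x ↦ v ⬝ x`, for a direction `v` over the base field. -/
def linForm (v : Fin n → K) (x : Fin n → R) : R := ∑ i, algebraMap K R (v i) * x i

/-- The quadratic form `S ↦ vᵗ S v`, for a direction `v` over the base field. -/
def quadForm (v : Fin n → K) (S : Matrix (Fin n) (Fin n) R) : R :=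
  ∑ i, ∑ j, algebraMap K R (v i) * algebraMap K R (v j) * S i j

theorem linForm_single (j : Fin n) (x : Fin n → R) :
    linForm (Pi.single j 1 : Fin n → K) x = x j := by
  simp [linForm, Pi.single_apply]

theorem linForm_add (v v' : Fin n → K) (x : Fin n → R) :
    linForm (v + v') x = linForm v x + linForm v' x := by
  simp [linForm, add_mul, sum_add_distrib]

theorem linForm_neg (v : Fin n → K) (x : Fin n → R) : linForm (-v) x = -linForm v x := by
  simp [linForm]

theorem linForm_sub_right (v : Fin n → K) (x y : Fin n → R) :
    linForm v (x - y) = linForm v x - linForm v y := by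
  simp [linForm, mul_sub]

theorem quadForm_single (j : Fin n) (S : Matrix (Fin n) (Fin n) R) :
    quadForm (Pi.single j 1 : Fin n → K) S = S j j := by
  simp [quadForm, Pi.single_apply]

theorem quadForm_single_add_single (i j : Fin n) (S : Matrix (Fin n) (Fin n) R) :
    quadForm (Pi.single i 1 + Pi.single j 1 : Fin n → K) S = S i i + S j j + (S i j + S j i) := by
  simp [quadForm, Pi.single_apply, add_mul, mul_add, sum_add_distrib]
  ring

end Directions

section Mixture

variable {K R : Type*} [Field K] [CharZero K] [CommRing R] [Algebra K R] [Algebra ℚ R] {n d : ℕ}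

/-- The `r`-th moment in the direction `v` of a mixture of two components with weights
`p` and `1 - p`. -/
theorem directionalMoment_two {w : Fin 2 → R} (hw : w 0 + w 1 = 1) (μ : Fin 2 → Fin n → R)
    (S : Matrix (Fin n) (Fin n) R) (v : Fin n → K) {r : ℕ} (hr : r ≤ d) :
    directionalMoment (fun a : MultiIndex n d => genericMoment w μ S a.1) v r =
      w 0 * gaussianMoment (linForm v (μ 0)) (quadForm v S) r +
        (1 - w 0) * gaussianMoment (linForm v (μ 1)) (quadForm v S) r := by
  rw [directionalMoment_genericMoment _ _ _ _ hr, Fin.sum_univ_two, ← hw, add_sub_cancel_left]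
  rfl

variable {w : Fin 2 → R} (hw : w 0 + w 1 = 1) (μ : Fin 2 → Fin n → R)
  (S : Matrix (Fin n) (Fin n) R) (v : Fin n → K)

include hw

theorem mean_two (hd : 1 ≤ d) :
    directionalMoment (fun a : MultiIndex n d => genericMoment w μ S a.1) v 1 =
      linForm v (μ 1) + w 0 * linForm v (μ 0 - μ 1) := by
  rw [directionalMoment_two hw _ _ _ hd, linForm_sub_right]
  simp only [gaussianMoment]
  ring

theorem secondCumulant_two (hd : 2 ≤ d) :
    secondCumulant (directionalMoment (fun a : MultiIndex n d => genericMoment w μ S a.1) v) =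
      quadForm v S + w 0 * (1 - w 0) * linForm v (μ 0 - μ 1) ^ 2 := by
  rw [secondCumulant, directionalMoment_two hw _ _ _ (by lia : 1 ≤ d),
    directionalMoment_two hw _ _ _ (by lia : 2 ≤ d), linForm_sub_right]
  simp only [gaussianMoment]
  push_cast
  ring

theorem thirdCumulant_two (hd : 3 ≤ d) :
    thirdCumulant (directionalMoment (fun a : MultiIndex n d => genericMoment w μ S a.1) v) =
      w 0 * (1 - w 0) * (1 - 2 * w 0) * linForm v (μ 0 - μ 1) ^ 3 := by
  rw [thirdCumulant, directionalMoment_two hw _ _ _ (by lia : 1 ≤ d),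
    directionalMoment_two hw _ _ _ (by lia : 2 ≤ d),
    directionalMoment_two hw _ _ _ (by lia : 3 ≤ d), linForm_sub_right]
  simp only [gaussianMoment]
  push_cast
  ring

theorem fourthCumulant_two (hd : 4 ≤ d) :
    fourthCumulant (directionalMoment (fun a : MultiIndex n d => genericMoment w μ S a.1) v) =
      w 0 * (1 - w 0) * (1 - 6 * (w 0 * (1 - w 0))) * linForm v (μ 0 - μ 1) ^ 4 := by
  rw [fourthCumulant, directionalMoment_two hw _ _ _ (by lia : 1 ≤ d),
    directionalMoment_two hw _ _ _ (by lia : 2 ≤ d),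
    directionalMoment_two hw _ _ _ (by lia : 3 ≤ d),
    directionalMoment_two hw _ _ _ (by lia : 4 ≤ d), linForm_sub_right]
  simp only [gaussianMoment]
  push_cast
  ring

theorem fifthCumulant_two (hd : 5 ≤ d) :
    fifthCumulant (directionalMoment (fun a : MultiIndex n d => genericMoment w μ S a.1) v) =
      w 0 * (1 - w 0) * (1 - 2 * w 0) * (1 - 12 * (w 0 * (1 - w 0))) *
        linForm v (μ 0 - μ 1) ^ 5 := by
  rw [fifthCumulant, directionalMoment_two hw _ _ _ (by lia : 1 ≤ d),
    directionalMoment_two hw _ _ _ (by lia : 2 ≤ d),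
    directionalMoment_two hw _ _ _ (by lia : 3 ≤ d),
    directionalMoment_two hw _ _ _ (by lia : 4 ≤ d),
    directionalMoment_two hw _ _ _ (by lia : 5 ≤ d), linForm_sub_right]
  simp only [gaussianMoment]
  push_cast
  ring

end Mixture

/-! ### Fibers of the moment map -/

section Fibers

variable {K : Type*} [Field K] [CharZero K] {n d : ℕ}

/-- The difference of the two means. -/
def Params.meanDiff (θ : Params K n 2) : Fin n → K := θ.mean 0 - θ.mean 1

omit [CharZero K] in
theorem Params.weight_zero_add_weight_one (θ : Params K n 2) : θ.weight 0 + θ.weight 1 = 1 := by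
  rw [← Fin.sum_univ_two, θ.weight_sum]

theorem momentMap_eq (θ : Params K n 2) :
    momentMap d θ = fun a : MultiIndex n d => genericMoment θ.weight θ.mean θ.cov a.1 :=
  funext fun a => momentMap_eq_genericMoment θ a

theorem momentMap_relabel {k : ℕ} (θ : Params K n k) (π : Equiv.Perm (Fin k)) :
    momentMap d (θ.relabel π) = momentMap d θ := by
  have h : mixtureMGF (θ.relabel π) = mixtureMGF θ :=
    Equiv.sum_comp π fun i => MvPowerSeries.C (θ.weight i) * gaussianMGF (θ.mean i) θ.cov
  funext a
  rw [momentMap, momentMap, h]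

theorem thirdCumulant_momentMap (θ : Params K n 2) (v : Fin n → K) (hd : 3 ≤ d) :
    thirdCumulant (directionalMoment (momentMap d θ) v) =
      θ.weight 0 * (1 - θ.weight 0) * (1 - 2 * θ.weight 0) * linForm v θ.meanDiff ^ 3 := by
  rw [momentMap_eq]
  exact thirdCumulant_two θ.weight_zero_add_weight_one _ _ _ hd

/-- A symmetric matrix is determined by its quadratic form. -/
theorem eq_of_quadForm_eq {S T : Matrix (Fin n) (Fin n) K} (hS : S.IsSymm) (hT : T.IsSymm)
    (h : ∀ v : Fin n → K, quadForm v S = quadForm v T) : S = T := by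
  ext i j
  have hi := h (Pi.single i 1)
  have hj := h (Pi.single j 1)
  have hij := h (Pi.single i 1 + Pi.single j 1)
  rw [quadForm_single, quadForm_single] at hi hj
  rw [quadForm_single_add_single, quadForm_single_add_single, hS.apply i j, hT.apply i j] at hij
  linear_combination (hij - hi - hj) / 2

/-- A vector `x` with `x i ≠ 0` is determined by `x i` and the cube of the linear form `v ⬝ x`. -/
theorem eq_of_linForm_cube_eq {x y : Fin n → K} {i : Fin n} (hi : x i = y i) (hx : x i ≠ 0)
    (h : ∀ v : Fin n → K, linForm v x ^ 3 = linForm v y ^ 3) : x = y := by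
  ext j
  have hj := h (Pi.single j 1)
  have hadd := h (Pi.single i 1 + Pi.single j 1)
  have hsub := h (Pi.single i 1 + -Pi.single j 1)
  simp only [linForm_add, linForm_neg, linForm_single, ← hi] at hj hadd hsub
  apply mul_left_cancel₀ (pow_ne_zero 2 hx)
  linear_combination (hadd - hsub - 2 * hj) / 6

/-- Once the weight and one coordinate of the difference of the means are known, the moments of
order at most three determine the mixture. -/
theorem eq_of_momentMap_eq (hd : 3 ≤ d) {θ θ' : Params K n 2} {i : Fin n}
    (hθ : momentMap d θ = momentMap d θ') (hw : θ.weight 0 = θ'.weight 0)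
    (hi : θ.meanDiff i = θ'.meanDiff i)
    (hne : thirdCumulant (directionalMoment (momentMap d θ) (Pi.single i 1 : Fin n → K)) ≠ 0) :
    θ = θ' := by
  rw [thirdCumulant_momentMap _ _ hd, linForm_single] at hne
  have hc : θ.weight 0 * (1 - θ.weight 0) * (1 - 2 * θ.weight 0) ≠ 0 := left_ne_zero_of_mul hne
  have hx : θ.meanDiff i ≠ 0 := by intro h; simp [h] at hne
  have hdiff : θ.meanDiff = θ'.meanDiff := by
    refine eq_of_linForm_cube_eq hi hx fun v => mul_left_cancel₀ hc ?_
    have h := thirdCumulant_momentMap θ' v hd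
    rw [← hθ, thirdCumulant_momentMap _ _ hd, ← hw] at h
    exact h
  have hw1 := θ.weight_zero_add_weight_one
  have hw1' := θ'.weight_zero_add_weight_one
  have h1 : θ.mean 1 = θ'.mean 1 := by
    ext j
    have h := mean_two hw1' θ'.mean θ'.cov (Pi.single j 1 : Fin n → K) (by lia : 1 ≤ d)
    rw [← momentMap_eq, ← hθ, momentMap_eq, mean_two hw1 _ _ _ (by lia : 1 ≤ d), linForm_single,
      linForm_single, linForm_single, linForm_single, ← hw] at h
    have hj := congrFun hdiff j
    rw [Params.meanDiff, Params.meanDiff] at hj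
    rw [hj] at h
    exact add_right_cancel h
  have h0 : θ.mean 0 = θ'.mean 0 := by
    rw [Params.meanDiff, Params.meanDiff, h1] at hdiff
    exact sub_left_injective hdiff
  have hcov : θ.cov = θ'.cov := by
    refine eq_of_quadForm_eq θ.cov_symm θ'.cov_symm fun v => ?_
    have h := secondCumulant_two hw1' θ'.mean θ'.cov v (by lia : 2 ≤ d)
    rw [← momentMap_eq, ← hθ, momentMap_eq, secondCumulant_two hw1 _ _ _ (by lia : 2 ≤ d), ← hw,
      h0, h1] at h
    exact add_right_cancel h
  ext l j
  · fin_cases l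
    · exact congrFun h0 j
    · exact congrFun h1 j
  · fin_cases l
    · exact hw
    · change θ.weight 1 = θ'.weight 1
      linear_combination hw1 - hw1' - hw
  · rw [hcov]

/-- Moments of order at most four leave finitely many choices for the weight, and then for one
coordinate of the difference of the means, provided the third cumulant in that coordinate is
nonzero. -/
theorem finite_fiber (hd : 4 ≤ d) {i : Fin n} {m : MultiIndex n d → K}
    (hne : thirdCumulant (directionalMoment m (Pi.single i 1 : Fin n → K)) ≠ 0) :
    {θ : Params K n 2 | momentMap d θ = m}.Finite := by
  set a := thirdCumulant (directionalMoment m (Pi.single i 1 : Fin n → K))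
  set b := fourthCumulant (directionalMoment m (Pi.single i 1 : Fin n → K))
  have hT : {y : K × K | (weightPolynomial a b).IsRoot y.1 ∧
      y.1 * (1 - y.1) * (1 - 2 * y.1) * y.2 ^ 3 = a}.Finite := by
    refine ((Polynomial.finite_setOfPred_isRoot (weightPolynomial_ne_zero hne b)).biUnion
      (t := fun p => Prod.mk p '' {x : K | p * (1 - p) * (1 - 2 * p) * x ^ 3 = a})
      fun p _ => Set.Finite.image _ ?_).subset ?_
    · have h0 : (Polynomial.C (p * (1 - p) * (1 - 2 * p)) * Polynomial.X ^ 3 - Polynomial.C a :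
          Polynomial K) ≠ 0 := by
        intro h
        have := congrArg (Polynomial.eval 0) h
        simp [hne] at this
      refine (Polynomial.finite_setOfPred_isRoot h0).subset fun x hx => ?_
      simpa [Polynomial.IsRoot, sub_eq_zero] using hx
    · rintro ⟨p, x⟩ ⟨hp, hx⟩
      exact Set.mem_biUnion (x := p) hp ⟨x, hx, rfl⟩
  refine Set.Finite.of_injOn (f := fun θ : Params K n 2 => (θ.weight 0, θ.meanDiff i)) ?_ ?_ hT
  · rintro θ rfl
    have hw := θ.weight_zero_add_weight_one
    have h4 := fourthCumulant_two hw θ.mean θ.cov (Pi.single i 1 : Fin n → K) hd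
    rw [← momentMap_eq] at h4
    have h3 := thirdCumulant_momentMap θ (Pi.single i 1) (by lia : 3 ≤ d)
    rw [linForm_single] at h3 h4
    refine ⟨?_, h3.symm⟩
    change Polynomial.eval (θ.weight 0) _ = 0
    rw [← Polynomial.coe_aeval_eq_eval]
    exact aeval_weightPolynomial h3 h4
  · rintro θ rfl θ' hθ' h
    rw [Prod.mk.injEq] at h
    exact eq_of_momentMap_eq (by lia) (Eq.symm hθ') h.1 h.2 hne

/-- Moments of order five or more determine the mixture up to label swapping, provided the third
cumulant in some coordinate direction is nonzero. -/
theorem fiber_eq_range_relabel (hd : 5 ≤ d) {i : Fin n} (θ : Params K n 2)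
    (hne : thirdCumulant (directionalMoment (momentMap d θ) (Pi.single i 1 : Fin n → K)) ≠ 0) :
    {θ' : Params K n 2 | momentMap d θ' = momentMap d θ} = Set.range θ.relabel := by
  refine Set.Subset.antisymm (fun θ' hθ' => ?_) ?_
  · have hθ' : momentMap d θ' = momentMap d θ := hθ'
    have hw := θ.weight_zero_add_weight_one
    have hw' := θ'.weight_zero_add_weight_one
    have h3 := thirdCumulant_two hw' θ'.mean θ'.cov (Pi.single i 1 : Fin n → K) (by lia : 3 ≤ d)
    have h4 := fourthCumulant_two hw' θ'.mean θ'.cov (Pi.single i 1 : Fin n → K) (by lia : 4 ≤ d)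
    have h5 := fifthCumulant_two hw' θ'.mean θ'.cov (Pi.single i 1 : Fin n → K) hd
    rw [← momentMap_eq, hθ', momentMap_eq] at h3 h4 h5
    rw [thirdCumulant_two hw _ _ _ (by lia : 3 ≤ d), linForm_single, linForm_single] at h3
    rw [fourthCumulant_two hw _ _ _ (by lia : 4 ≤ d), linForm_single, linForm_single] at h4
    rw [fifthCumulant_two hw _ _ _ hd, linForm_single, linForm_single] at h5
    have hne' := hne
    rw [thirdCumulant_momentMap _ _ (by lia), linForm_single] at hne'
    rcases eq_or_swap_of_cumulants h3 h4 h5 hne' with ⟨hp, hx⟩ | ⟨hp, hx⟩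
    · exact ⟨Equiv.refl _, eq_of_momentMap_eq (by lia) hθ'.symm hp.symm hx.symm hne⟩
    · refine ⟨Equiv.swap 0 1, eq_of_momentMap_eq (i := i) (d := d) (by lia) ?_ ?_ ?_ ?_⟩
      · rw [momentMap_relabel, hθ']
      · change θ.weight (Equiv.swap 0 1 0) = _
        rw [hp, Equiv.swap_apply_left, ← hw, add_sub_cancel_left]
      · change θ.mean (Equiv.swap 0 1 0) i - θ.mean (Equiv.swap 0 1 1) i = _
        rw [Equiv.swap_apply_left, Equiv.swap_apply_right]
        exact (neg_sub (θ.mean 0 i) (θ.mean 1 i)).symm.trans hx.symm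
      · rwa [momentMap_relabel]
  · rintro _ ⟨π, rfl⟩
    exact momentMap_relabel θ π

/-- A mixture, with one weight `2` and the other `-1`, whose third cumulant in the direction of the
`i`-th coordinate is nonzero. -/
theorem exists_thirdCumulant_ne_zero (hd : 3 ≤ d) (i : Fin n) :
    ∃ θ : Params K n 2,
      thirdCumulant (directionalMoment (momentMap d θ) (Pi.single i 1 : Fin n → K)) ≠ 0 := by
  refine ⟨⟨![Pi.single i 1, 0], ![2, -1], 0, by rw [Fin.sum_univ_two]; norm_num,
    Matrix.isSymm_zero⟩, ?_⟩
  rw [thirdCumulant_momentMap _ _ hd, linForm_single]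
  simp [Params.meanDiff]
  norm_num

/-- The third cumulant in a coordinate direction is a polynomial in the moments that does not vanish
identically on the secant variety, so a general point may be taken outside its zero locus. -/
theorem forGeneralPoint_secant (hd : 3 ≤ d) (i : Fin n) {P : (MultiIndex n d → K) → Prop}
    (h : ∀ θ : Params K n 2,
      thirdCumulant (directionalMoment (momentMap d θ) (Pi.single i 1 : Fin n → K)) ≠ 0 →
        P (momentMap d θ)) :
    ForGeneralPoint (homoscedasticSecant K n 2 d) P := by
  set Q : MvPolynomial (MultiIndex n d) K :=
    thirdCumulant (directionalMoment MvPolynomial.X (Pi.single i 1 : Fin n → K)) with hQ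
  have heval : ∀ m, MvPolynomial.eval m Q =
      thirdCumulant (directionalMoment m (Pi.single i 1 : Fin n → K)) := by
    intro m
    rw [hQ, map_thirdCumulant]
    congr 1
    funext r
    rw [← MvPolynomial.coe_aeval_eq_eval, RingHom.coe_coe, map_directionalMoment]
    simp only [MvPolynomial.aeval_X]
  obtain ⟨θ₀, hθ₀⟩ := exists_thirdCumulant_ne_zero (K := K) hd i
  refine ⟨Q, ⟨_, ⟨θ₀, rfl⟩, by rwa [heval]⟩, ?_⟩
  rintro _ ⟨θ, rfl⟩ hm
  exact h θ (by rwa [heval] at hm)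

end Fibers

/-! ### Dimension of the secant variety -/

open MvPolynomial

/-- Coordinates on the parameter space of two-component mixtures: the entries of the means, the
first weight, and the entries of the covariance matrix, indexed by unordered pairs. -/
abbrev ParamIndex (n : ℕ) : Type := (Fin 2 × Fin n) ⊕ (Unit ⊕ Sym2 (Fin n))

theorem card_paramIndex (n : ℕ) : Fintype.card (ParamIndex n) = paramDim n 2 := by
  simp only [Fintype.card_sum, Fintype.card_prod, Fintype.card_fin, Fintype.card_unit, Sym2.card,
    Nat.choose_two_right, paramDim, Nat.add_sub_cancel]
  rw [mul_comm (n + 1) n]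
  ring

section Generic

variable (K : Type*) [Field K] [CharZero K] (n : ℕ)

/-- The weights of the generic mixture. -/
noncomputable def genericWeight : Fin 2 → MvPolynomial (ParamIndex n) K :=
  ![X (.inr (.inl ())), 1 - X (.inr (.inl ()))]

/-- The means of the generic mixture. -/
noncomputable def genericMean (l : Fin 2) (j : Fin n) : MvPolynomial (ParamIndex n) K :=
  X (.inl (l, j))

/-- The covariance matrix of the generic mixture. -/
noncomputable def genericCov : Matrix (Fin n) (Fin n) (MvPolynomial (ParamIndex n) K) :=
  Matrix.of fun i j => X (.inr (.inr s(i, j)))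

/-- The moment map as a polynomial map: the moments of the generic mixture. -/
noncomputable def genericMomentMap (d : ℕ) (a : MultiIndex n d) : MvPolynomial (ParamIndex n) K :=
  genericMoment (genericWeight K n) (genericMean K n) (genericCov K n) a.1

omit [CharZero K] in
theorem genericWeight_sum : genericWeight K n 0 + genericWeight K n 1 = 1 := by
  simp [genericWeight]

variable {K n}

/-- The mixture with given coordinates. -/
def Params.ofCoords (v : ParamIndex n → K) : Params K n 2 where
  mean l j := v (.inl (l, j))
  weight := ![v (.inr (.inl ())), 1 - v (.inr (.inl ()))]
  cov := Matrix.of fun i j => v (.inr (.inr s(i, j)))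
  weight_sum := by rw [Fin.sum_univ_two]; simp
  cov_symm := by ext i j; simp [Sym2.eq_swap]

omit [CharZero K] in
theorem Params.ofCoords_surjective :
    Function.Surjective (Params.ofCoords : (ParamIndex n → K) → Params K n 2) := by
  intro θ
  refine ⟨Sum.elim (fun x => θ.mean x.1 x.2) (Sum.elim (fun _ => θ.weight 0)
    (Sym2.lift ⟨fun i j => θ.cov i j, fun i j => (θ.cov_symm.apply i j).symm⟩)), ?_⟩
  ext l j
  · rfl
  · fin_cases l
    · rfl
    · change 1 - θ.weight 0 = θ.weight 1
      rw [← θ.weight_zero_add_weight_one, add_sub_cancel_left]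
  · rfl

theorem eval_genericMomentMap {d : ℕ} (v : ParamIndex n → K) (a : MultiIndex n d) :
    eval v (genericMomentMap K n d a) = momentMap d (Params.ofCoords v) a := by
  rw [genericMomentMap, map_genericMoment, momentMap_eq_genericMoment]
  congr 1
  · ext l
    fin_cases l <;> simp [genericWeight, Params.ofCoords]
  · ext l j
    simp [genericMean, Params.ofCoords]
  · ext i j
    simp [genericCov, Params.ofCoords]

theorem homoscedasticSecant_eq_range (d : ℕ) :
    homoscedasticSecant K n 2 d =
      Set.range fun (v : ParamIndex n → K) a => eval v (genericMomentMap K n d a) := by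
  simp_rw [eval_genericMomentMap]
  rw [homoscedasticSecant]
  exact (Params.ofCoords_surjective.range_comp (momentMap d)).symm

/-- The parameters of the generic mixture are algebraic over its moments of order at most four: the
weight is a root of a polynomial in the third and fourth cumulants, the difference of the means is
then a cube root, and the remaining parameters are linear in the first two cumulants. -/
theorem isAlgebraic_parameter {d : ℕ} (hd : 4 ≤ d) (i₀ : Fin n) (t : ParamIndex n) :
    IsAlgebraic (Algebra.adjoin K (Set.range (genericMomentMap K n d)))
      (X t : MvPolynomial (ParamIndex n) K) := by
  set A := Algebra.adjoin K (Set.range (genericMomentMap K n d))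
  have hm : ∀ v r, directionalMoment (genericMomentMap K n d) v r ∈ A :=
    directionalMoment_mem A _ fun a => Algebra.subset_adjoin ⟨a, rfl⟩
  let M : (Fin n → K) → ℕ → A := fun v r => ⟨_, hm v r⟩
  set B := MvPolynomial (ParamIndex n) K
  set p : B := X (.inr (.inl ()))
  let δ : Fin n → B := genericMean K n 0 - genericMean K n 1
  have h1 : ∀ v, algebraMap A B (M v 1) = linForm v (genericMean K n 1) + p * linForm v δ :=
    fun v => mean_two (genericWeight_sum K n) _ _ _ (by lia)
  have h2 : ∀ v, algebraMap A B (secondCumulant (M v)) =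
      quadForm v (genericCov K n) + p * (1 - p) * linForm v δ ^ 2 := fun v =>
    (map_secondCumulant _ _).trans (secondCumulant_two (genericWeight_sum K n) _ _ _ (by lia))
  have h3 : ∀ v, algebraMap A B (thirdCumulant (M v)) =
      p * (1 - p) * (1 - 2 * p) * linForm v δ ^ 3 := fun v =>
    (map_thirdCumulant _ _).trans (thirdCumulant_two (genericWeight_sum K n) _ _ _ (by lia))
  have h4 : ∀ v, algebraMap A B (fourthCumulant (M v)) =
      p * (1 - p) * (1 - 6 * (p * (1 - p))) * linForm v δ ^ 4 := fun v =>
    (map_fourthCumulant _ _).trans (fourthCumulant_two (genericWeight_sum K n) _ _ _ hd)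
  have hne : thirdCumulant (M (Pi.single i₀ 1)) ≠ 0 := by
    obtain ⟨θ₀, hθ₀⟩ := exists_thirdCumulant_ne_zero (K := K) (by lia : 3 ≤ d) i₀
    obtain ⟨x, rfl⟩ := Params.ofCoords_surjective θ₀
    intro h0
    apply hθ₀
    have h := congrArg (fun y => eval x (algebraMap A B y)) h0
    simp only [map_zero, map_thirdCumulant] at h
    rw [← h]
    congr 1
    funext r
    change _ = eval x (directionalMoment (genericMomentMap K n d) _ r)
    rw [← coe_aeval_eq_eval, RingHom.coe_coe, map_directionalMoment]
    congr 1
    funext a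
    rw [← eval_genericMomentMap]
    rfl
  -- the elements of the generic parameter ring that are algebraic over the moments form a ring
  set C := Subalgebra.algebraicClosure A B
  have hAC : ∀ a : A, algebraMap A B a ∈ C := fun a => C.algebraMap_mem a
  have hpC : p ∈ C := ⟨_, weightPolynomial_ne_zero hne _, aeval_weightPolynomial (h3 _) (h4 _)⟩
  have hqC : 1 - p ∈ C := C.sub_mem C.one_mem hpC
  have hwC : 1 - 2 * p ∈ C := C.sub_mem C.one_mem (C.mul_mem (ofNat_mem C 2) hpC)
  have hc : p * (1 - p) * (1 - 2 * p) ≠ 0 := by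
    intro h
    apply hne
    apply FaithfulSMul.algebraMap_injective A B
    rw [h3, h, zero_mul, map_zero]
  have hδ : ∀ v : Fin n → K, linForm v δ ∈ C := by
    intro v
    have h : IsAlgebraic A (p * (1 - p) * (1 - 2 * p) * linForm v δ ^ 3) := h3 v ▸ hAC _
    exact (IsAlgebraic.of_mul (mem_nonZeroDivisors_of_ne_zero hc)
      (C.mul_mem (C.mul_mem hpC hqC) hwC) h).of_pow (by norm_num)
  have hμ : ∀ j, genericMean K n 1 j ∈ C := by
    intro j
    have h := C.sub_mem (hAC (M (Pi.single j 1) 1)) (C.mul_mem hpC (hδ (Pi.single j 1)))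
    rwa [h1, add_sub_cancel_right, linForm_single] at h
  have hquad : ∀ v : Fin n → K, quadForm v (genericCov K n) ∈ C := by
    intro v
    have h := C.sub_mem (hAC (secondCumulant (M v)))
      (C.mul_mem (C.mul_mem hpC hqC) (C.pow_mem (hδ v) 2))
    rwa [h2, add_sub_cancel_right] at h
  rcases t with ⟨l, j⟩ | _ | s
  · fin_cases l
    · have h := C.add_mem (hδ (Pi.single j 1)) (hμ j)
      rw [linForm_single] at h
      have e : δ j + genericMean K n 1 j = genericMean K n 0 j := sub_add_cancel _ _
      rw [e] at h
      exact h
    · exact hμ j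
  · exact hpC
  · induction s using Sym2.ind with
    | _ i j =>
      have h := C.sub_mem (C.sub_mem (hquad (Pi.single i 1 + Pi.single j 1))
        (hquad (Pi.single i 1))) (hquad (Pi.single j 1))
      rw [quadForm_single_add_single, quadForm_single, quadForm_single] at h
      have hs : genericCov K n j i = genericCov K n i j := by simp [genericCov, Sym2.eq_swap]
      have e : genericCov K n i i + genericCov K n j j + (genericCov K n i j + genericCov K n j i) -
          genericCov K n i i - genericCov K n j j = 2 * genericCov K n i j := by
        rw [hs]; ring
      rw [e] at h
      exact IsAlgebraic.of_mul (mem_nonZeroDivisors_of_ne_zero two_ne_zero) (ofNat_mem C 2) h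

theorem zariskiDim_homoscedasticSecant {d : ℕ} (hn : 1 ≤ n) (hd : 4 ≤ d) :
    zariskiDim (homoscedasticSecant K n 2 d) = (paramDim n 2 : WithBot ℕ∞) := by
  have : Finite (MultiIndex n d) := (Finsupp.finite_of_degree_le d).to_subtype
  rw [homoscedasticSecant_eq_range, zariskiDim_range_eq_card _ (isAlgebraic_parameter hd ⟨0, hn⟩),
    card_paramIndex]

theorem algebraicallyIdentifiable_two {d : ℕ} (hn : 1 ≤ n) (hd : 4 ≤ d) :
    AlgebraicallyIdentifiable K n 2 d :=
  ⟨zariskiDim_homoscedasticSecant hn hd,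
    forGeneralPoint_secant (by lia) ⟨0, hn⟩ fun _ h => finite_fiber hd h⟩

theorem rationallyIdentifiable_two {d : ℕ} (hn : 1 ≤ n) (hd : 5 ≤ d) :
    RationallyIdentifiable K n 2 d :=
  forGeneralPoint_secant (by lia) ⟨0, hn⟩ fun θ h => ⟨θ, fiber_eq_range_relabel hd θ h⟩

end Generic

end HomoscedasticMixture

theorem mainTheorem3 {𝕜 : Type*} [RCLike 𝕜] (n : ℕ) (hn : 1 ≤ n) :
    HomoscedasticMixture.AlgebraicallyIdentifiable 𝕜 n 2 4 ∧
      ∀ d : ℕ, 5 ≤ d →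
        HomoscedasticMixture.AlgebraicallyIdentifiable 𝕜 n 2 d ∧
          HomoscedasticMixture.RationallyIdentifiable 𝕜 n 2 d :=
  ⟨HomoscedasticMixture.algebraicallyIdentifiable_two hn le_rfl, fun _ hd =>
    ⟨HomoscedasticMixture.algebraicallyIdentifiable_two hn (by lia),
      HomoscedasticMixture.rationallyIdentifiable_two hn hd⟩⟩
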